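/- Let $e_0(z)=z$ and $e_{j+1}(z)=e^{e_j(z)}$ for $j\ge 0$, and let $\mathbb Q^{alg}\subset\mathbb C$ be the field of algebraic numbers. For complex numbers $c_0,\dots,c_m$ let $\mathrm{td}_{\mathbb Q}(c_0,\dots,c_m)$ denote the transcendence degree of $\mathbb Q(c_0,\dots,c_m)$ over $\mathbb Q$. Assume Schanuel's Conjecture: for every $n$ and all $\lambda_1,\dots,\lambda_n\in\mathbb C$ that are linearly independent over $\mathbb Q$, one has $\mathrm{td}_{\mathbb Q}(\lambda_1,\dots,\lambda_n,e^{\lambda_1},\dots,e^{\lambda_n})\ge n$. Let $k\ge 2$ be an integer and let $p\in\mathbb Q^{alg}[x_0,\dots,x_k]$ be an irreducible polynomial in which both variables $x_0$ and $x_k$ occur. Then there is $a\in\mathbb C$ such that $$p(a,e_1(a),\dots,e_k(a))=0\qquad\text{and}\qquad \mathrm{td}_{\mathbb Q}(a,e_1(a),\dots,e_k(a))\notin\{0,\,1,\,k-1\}.$$ -/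

import Mathlib

/-- The iterated exponentials: `e_0(z) = z` and `e_{j+1}(z) = exp (e_j(z))`. -/
noncomputable def iterExp : ℕ → ℂ → ℂ
  | 0, z => z
  | j + 1, z => Complex.exp (iterExp j z)

/-- The transcendence degree over `ℚ` of a set `S` of complex numbers, that is, the transcendence
degree of the field extension `ℚ(S) / ℚ`. -/
noncomputable def tdQ (S : Set ℂ) : Cardinal :=
  Algebra.trdeg ℚ (IntermediateField.adjoin ℚ S)

/-- Schanuel's Conjecture: if `l_1, …, l_n` are complex numbers that are linearly independent
over `ℚ`, then `ℚ(l_1, …, l_n, exp l_1, …, exp l_n)` has transcendence degree at least `n`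
over `ℚ`. -/
def SchanuelConjecture : Prop :=
  ∀ (n : ℕ) (l : Fin n → ℂ), LinearIndependent ℚ l →
    (n : Cardinal) ≤ tdQ (Set.range l ∪ Set.range fun i => Complex.exp (l i))

/-- The field of complex numbers that are algebraic over `ℚ`. -/
noncomputable abbrev QAlg : IntermediateField ℚ ℂ := algebraicClosure ℚ ℂ

/-! The idea is to find a zero `a` at which `a, e_1(a), …, e_{k-1}(a)` satisfy no nontrivial integer
linear relation with coefficients bounded by a constant `D` depending only on `p`. Schanuel's
Conjecture then turns each forbidden transcendence degree into such a bounded relation.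

Analysis (`exists_exp_iterLog_zero`, `exists_iterExp_zero_avoiding`): put `u = e_{k-1}(a)`. Then `p`
becomes a polynomial in `exp u` whose coefficients are polynomials in the iterated logarithms of
`u`, and these vary slowly. Near `2πim`, after a real shift and division by the constant
coefficient, a subsequence converges to a nonconstant exponential polynomial `1 + ∑ a_j
exp((j+1)v)`. This has a zero, and Hurwitz's argument gives solutions `u` for arbitrarily large `m`.
A nonzero polynomial in the iterated logarithms does not vanish far out, so the finitely many
bounded relations are avoided.

Arithmetic: degree `0` contradicts Schanuel for the single number `a ≠ 0`. In degree `k-1`, Schanuel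
gives an integer relation `m` of unknown size. Eliminating one coordinate from `p` leaves a
polynomial of no larger degree vanishing at a generic point of a subtorus of codimension one. Two of
its monomials must agree there, and the difference of their exponents is a bounded multiple of `m`
(`exists_proportional_exponent`, `exists_bounded_relation`). In degree `1` with `k ≥ 3`, Schanuel
for pairs makes `e_1(a)` and `e_2(a)` rational multiples of `a`, which forces `exp a = a`, again a
bounded relation. -/

open Filter Asymptotics Topology

/-! ### Polynomials in functions of widely separated growth -/

/-- The functions `z 0, z 1, …` tend to infinity along `l`, and every power of `z j` is negligible
with respect to `z i` for `i < j`. -/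
structure IsHierarchy {α : Type} (l : Filter α) {n : ℕ} (z : Fin n → α → ℂ) : Prop where
  one_isLittleO : ∀ i : Fin n, (fun _ => (1 : ℂ)) =o[l] z i
  pow_isLittleO : ∀ i j : Fin n, i < j → ∀ N : ℕ, (fun a => z j a ^ N) =o[l] z i

theorem IsHierarchy.tail {α : Type} {l : Filter α} {n : ℕ} {z : Fin (n + 1) → α → ℂ}
    (hz : IsHierarchy l z) : IsHierarchy l (fun i => z i.succ) :=
  ⟨fun _ => hz.one_isLittleO _, fun _ _ h => hz.pow_isLittleO _ _ (Fin.succ_lt_succ_iff.2 h)⟩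

theorem IsHierarchy.eventually_one_le {α : Type} {l : Filter α} {n : ℕ} {z : Fin n → α → ℂ}
    (hz : IsHierarchy l z) (i : Fin n) : ∀ᶠ a in l, 1 ≤ ‖z i a‖ := by
  filter_upwards [(hz.one_isLittleO i).bound one_pos] with a ha
  simpa using ha

theorem IsHierarchy.eventually_ne_zero {α : Type} {l : Filter α} {n : ℕ} {z : Fin n → α → ℂ}
    (hz : IsHierarchy l z) (i : Fin n) : ∀ᶠ a in l, z i a ≠ 0 := by
  filter_upwards [hz.eventually_one_le i] with a ha h
  norm_num [h] at ha

theorem add_pow_isLittleO {α : Type} {l : Filter α} {f g h : α → ℂ}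
    (hf : ∀ N : ℕ, (fun a => f a ^ N) =o[l] h) (hg : ∀ N : ℕ, (fun a => g a ^ N) =o[l] h)
    (N : ℕ) : (fun a => (f a + g a) ^ N) =o[l] h := by
  have h1 : (fun a => ‖f a‖ ^ N + ‖g a‖ ^ N) =o[l] h := by
    refine IsLittleO.add ?_ ?_
    · simpa only [norm_pow] using (hf N).norm_left
    · simpa only [norm_pow] using (hg N).norm_left
  refine IsBigO.trans_isLittleO (IsBigO.of_bound (2 ^ N) (Eventually.of_forall fun a => ?_)) h1
  have hx := norm_nonneg (f a)
  have hy := norm_nonneg (g a)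
  rw [norm_pow, Real.norm_of_nonneg (by positivity)]
  calc ‖f a + g a‖ ^ N ≤ (2 * max ‖f a‖ ‖g a‖) ^ N := by
        gcongr
        refine (norm_add_le _ _).trans ?_
        linarith [le_max_left ‖f a‖ ‖g a‖, le_max_right ‖f a‖ ‖g a‖]
    _ = 2 ^ N * (max ‖f a‖ ‖g a‖) ^ N := by rw [mul_pow]
    _ ≤ 2 ^ N * (‖f a‖ ^ N + ‖g a‖ ^ N) := by
        gcongr
        rcases max_cases ‖f a‖ ‖g a‖ with ⟨h, -⟩ | ⟨h, -⟩ <;> rw [h]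
        · exact le_add_of_nonneg_right (by positivity)
        · exact le_add_of_nonneg_left (by positivity)

theorem mul_pow_isLittleO {α : Type} {l : Filter α} {f g h : α → ℂ}
    (hf : ∀ N : ℕ, (fun a => f a ^ N) =o[l] h) (hg : ∀ N : ℕ, (fun a => g a ^ N) =o[l] h)
    (N : ℕ) : (fun a => (f a * g a) ^ N) =o[l] h := by
  have h1 : (fun a => ‖f a‖ ^ (2 * N) + ‖g a‖ ^ (2 * N)) =o[l] h := by
    refine IsLittleO.add ?_ ?_
    · simpa only [norm_pow] using (hf (2 * N)).norm_left
    · simpa only [norm_pow] using (hg (2 * N)).norm_left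
  refine IsBigO.trans_isLittleO (IsBigO.of_bound 1 (Eventually.of_forall fun a => ?_)) h1
  have hx := norm_nonneg (f a)
  have hy := norm_nonneg (g a)
  rw [norm_pow, norm_mul, Real.norm_of_nonneg (by positivity), one_mul, mul_pow, pow_mul', pow_mul']
  nlinarith [sq_nonneg (‖f a‖ ^ N - ‖g a‖ ^ N), sq_nonneg (‖f a‖ ^ N), sq_nonneg (‖g a‖ ^ N)]

theorem aeval_pow_isLittleO {K : Type*} [Field K] [Algebra K ℂ] {α : Type} {l : Filter α} {n : ℕ}
    {z : Fin (n + 1) → α → ℂ} (hz : IsHierarchy l z) (P : MvPolynomial (Fin n) K) (N : ℕ) :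
    (fun a => MvPolynomial.aeval (fun i => z i.succ a) P ^ N) =o[l] z 0 := by
  induction P using MvPolynomial.induction_on generalizing N with
  | C c =>
    simp only [MvPolynomial.algHom_C]
    refine IsBigO.trans_isLittleO ?_ (hz.one_isLittleO 0)
    exact isBigO_const_const _ one_ne_zero _
  | add p q hp hq =>
    simp only [map_add]
    exact add_pow_isLittleO hp hq N
  | mul_X p i hp =>
    simp only [map_mul, MvPolynomial.aeval_X]
    exact mul_pow_isLittleO hp (fun N => hz.pow_isLittleO _ _ (Fin.succ_pos i) N) N

theorem aeval_eq_sum_finSuccEquiv {K A : Type*} [CommSemiring K] [CommSemiring A] [Algebra K A]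
    {n : ℕ} (P : MvPolynomial (Fin (n + 1)) K) (z : Fin (n + 1) → A) :
    MvPolynomial.aeval z P = ∑ j ∈ Finset.range ((MvPolynomial.finSuccEquiv K n P).natDegree + 1),
      MvPolynomial.aeval (fun i => z i.succ) ((MvPolynomial.finSuccEquiv K n P).coeff j)
        * z 0 ^ j := by
  have h : MvPolynomial.aeval z P = Polynomial.eval₂ (MvPolynomial.aeval
      (fun i : Fin n => z i.succ) : MvPolynomial (Fin n) K →ₐ[K] A).toRingHom (z 0)
      (MvPolynomial.finSuccEquiv K n P) := by
    induction P using MvPolynomial.induction_on with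
    | C c =>
      rw [← MvPolynomial.algebraMap_eq, AlgEquiv.commutes, AlgHom.commutes,
        Polynomial.algebraMap_apply, Polynomial.eval₂_C]
      exact (AlgHom.commutes _ _).symm
    | add p q hp hq => simp only [map_add, Polynomial.eval₂_add, hp, hq]
    | mul_X p i hp =>
      simp only [map_mul, Polynomial.eval₂_mul, hp, MvPolynomial.aeval_X]
      refine Fin.cases ?_ (fun i => ?_) i
      · simp [MvPolynomial.finSuccEquiv_X_zero]
      · simp [MvPolynomial.finSuccEquiv_X_succ]
  rw [h, Polynomial.eval₂_eq_sum_range]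
  rfl

/-- The lexicographically leading monomial dominates, by induction on the number of variables
through the leading coefficient in the largest one. Since `e` and `C` depend on `P` alone, two
hierarchies can be compared. -/
theorem exists_leading_term {K : Type*} [Field K] [Algebra K ℂ] {n : ℕ}
    (P : MvPolynomial (Fin n) K) (hP : P ≠ 0) :
    ∃ (e : Fin n → ℕ) (C : ℂ), C ≠ 0 ∧ ∀ {α : Type} (l : Filter α) (z : Fin n → α → ℂ),
      IsHierarchy l z →
      Tendsto (fun a => MvPolynomial.aeval (fun i => z i a) P / ∏ i, z i a ^ e i) l (𝓝 C) := by
  induction n with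
  | zero =>
    refine ⟨fun _ => 0, algebraMap K ℂ (P.coeff 0), ?_, fun l z _ => ?_⟩
    · rw [Ne, FaithfulSMul.algebraMap_eq_zero_iff]
      intro h
      apply hP
      rw [MvPolynomial.eq_C_of_isEmpty P, h, map_zero]
    · rw [MvPolynomial.eq_C_of_isEmpty P]
      simpa using tendsto_const_nhds
  | succ n ih =>
    set Q := MvPolynomial.finSuccEquiv K n P with hQ
    have hQ0 : Q ≠ 0 := by simpa [hQ] using hP
    obtain ⟨e, C, hC, H⟩ := ih Q.leadingCoeff (by simpa using hQ0)
    refine ⟨Fin.cons Q.natDegree e, C, hC, fun l z hz => ?_⟩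
    have key : ∀ a, MvPolynomial.aeval (fun i => z i a) P /
        ∏ i, z i a ^ (Fin.cons Q.natDegree e : Fin (n + 1) → ℕ) i =
        ∑ j ∈ Finset.range Q.natDegree, (MvPolynomial.aeval (fun i => z i.succ a) (Q.coeff j)
          * z 0 a ^ j / (z 0 a ^ Q.natDegree * ∏ i, z (Fin.succ i) a ^ e i)) +
        MvPolynomial.aeval (fun i => z i.succ a) Q.leadingCoeff * z 0 a ^ Q.natDegree /
          (z 0 a ^ Q.natDegree * ∏ i, z (Fin.succ i) a ^ e i) := by
      intro a
      rw [aeval_eq_sum_finSuccEquiv, Fin.prod_univ_succ, Finset.sum_range_succ, add_div,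
        Finset.sum_div]
      rfl
    simp only [key]
    rw [← zero_add C]
    refine Tendsto.add ?_ ?_
    · rw [← Finset.sum_const_zero (s := Finset.range Q.natDegree) (M := ℂ)]
      refine tendsto_finsetSum (Finset.range Q.natDegree) fun j hj => ?_
      have hj' : j + 1 ≤ Q.natDegree := Finset.mem_range.1 hj
      have h0 := (aeval_pow_isLittleO hz (Q.coeff j) 1).tendsto_div_nhds_zero
      simp only [pow_one] at h0
      -- A lower term has a spare power of `z 0` in the denominator, and its coefficient is `o(z
      -- 0)`; the other factors of the denominator have norm at least one.
      refine squeeze_zero_norm' ?_ (tendsto_zero_iff_norm_tendsto_zero.1 h0)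
      have hall : ∀ᶠ a in l, ∀ i, 1 ≤ ‖z i a‖ := eventually_all.2 hz.eventually_one_le
      filter_upwards [hall] with a ha
      have hM : 1 ≤ ‖∏ i, z (Fin.succ i) a ^ e i‖ := by
        rw [norm_prod]
        refine Finset.prod_induction _ (fun x => 1 ≤ x)
          (fun _ _ => one_le_mul_of_one_le_of_one_le) le_rfl (fun i _ => ?_)
        rw [norm_pow]
        exact one_le_pow₀ (ha _)
      have hz0 : 1 ≤ ‖z 0 a‖ := ha 0
      rw [norm_div, norm_div, norm_mul, norm_mul, norm_pow, norm_pow]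
      rw [div_le_div_iff₀ (by positivity) (by positivity)]
      calc ‖MvPolynomial.aeval (fun i => z i.succ a) (Q.coeff j)‖ * ‖z 0 a‖ ^ j * ‖z 0 a‖
          = ‖MvPolynomial.aeval (fun i => z i.succ a) (Q.coeff j)‖ * (‖z 0 a‖ ^ (j + 1) * 1) := by
            ring
        _ ≤ _ := by
            gcongr
    · refine (H l _ hz.tail).congr' ?_
      filter_upwards [hz.eventually_ne_zero 0] with a ha
      rw [mul_comm, mul_div_mul_left _ _ (pow_ne_zero _ ha)]

theorem IsHierarchy.eventually_aeval_ne_zero {K : Type*} [Field K] [Algebra K ℂ] {n : ℕ}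
    {P : MvPolynomial (Fin n) K} (hP : P ≠ 0) {α : Type} {l : Filter α} {z : Fin n → α → ℂ}
    (hz : IsHierarchy l z) : ∀ᶠ a in l, MvPolynomial.aeval (fun i => z i a) P ≠ 0 := by
  obtain ⟨e, C, hC, H⟩ := exists_leading_term P hP
  filter_upwards [(H l z hz).eventually_ne hC] with a ha h
  simp [h] at ha

theorem tendsto_aeval_div_aeval {K : Type*} [Field K] [Algebra K ℂ] {n : ℕ}
    {P : MvPolynomial (Fin n) K} (hP : P ≠ 0) {α : Type} {l : Filter α} {z w : Fin n → α → ℂ}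
    (hz : IsHierarchy l z) (hw : IsHierarchy l w)
    (h : ∀ i, Tendsto (fun a => z i a / w i a) l (𝓝 1)) :
    Tendsto (fun a => MvPolynomial.aeval (fun i => z i a) P / MvPolynomial.aeval (fun i => w i a) P)
      l (𝓝 1) := by
  obtain ⟨e, C, hC, H⟩ := exists_leading_term P hP
  have h1 := ((H l z hz).div (H l w hw) hC).mul
    (tendsto_finsetProd Finset.univ fun i _ => (h i).pow (e i))
  simp only [one_pow, Finset.prod_const_one, mul_one, div_self hC] at h1
  refine h1.congr' ?_
  filter_upwards [eventually_all.2 hz.eventually_ne_zero, eventually_all.2 hw.eventually_ne_zero]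
    with a ha hb
  have h2 : ∏ i, z i a ^ e i ≠ 0 := Finset.prod_ne_zero_iff.2 fun i _ => pow_ne_zero _ (ha i)
  have h3 : ∏ i, w i a ^ e i ≠ 0 := Finset.prod_ne_zero_iff.2 fun i _ => pow_ne_zero _ (hb i)
  simp only [div_pow, Finset.prod_div_distrib, Pi.div_apply]
  generalize ∏ i, z i a ^ e i = s at *
  generalize ∏ i, w i a ^ e i = t at *
  rw [div_div_div_eq, div_mul_div_comm, mul_assoc, mul_comm s _, mul_assoc, mul_comm s t,
    mul_div_mul_right _ _ (mul_ne_zero h3 h2)]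

/-- By the leading term, `log ‖P‖` is a fixed combination of the `log ‖z i‖` up to a bounded error.
This keeps the shift in `exists_shift` negligible. -/
theorem IsHierarchy.log_norm_aeval_isLittleO {K : Type*} [Field K] [Algebra K ℂ] {n : ℕ}
    {P : MvPolynomial (Fin (n + 1)) K} (hP : P ≠ 0) {α : Type} {l : Filter α}
    {z : Fin (n + 1) → α → ℂ} (hz : IsHierarchy l z) :
    (fun a => Real.log ‖MvPolynomial.aeval (fun i => z i a) P‖) =o[l] z 0 := by
  obtain ⟨e, C, hC, H⟩ := exists_leading_term P hP
  have hO : ∀ i, z i =O[l] z 0 := by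
    intro i
    rcases eq_or_ne i 0 with rfl | hi
    · exact isBigO_refl _ _
    · simpa using (hz.pow_isLittleO 0 i (Fin.pos_of_ne_zero hi) 1).isBigO
  have hlog : ∀ i, (fun a => Real.log ‖z i a‖) =o[l] z 0 := by
    intro i
    have h1 : Tendsto (fun a => ‖z i a‖) l atTop :=
      (isLittleO_const_left.1 (hz.one_isLittleO i)).resolve_left one_ne_zero
    have h2 := (Real.isLittleO_log_id_atTop.comp_tendsto h1)
    refine IsLittleO.trans_isBigO h2 ?_
    exact (hO i).norm_left
  have h0 : (fun a => Real.log ‖MvPolynomial.aeval (fun i => z i a) P / ∏ i, z i a ^ e i‖)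
      =o[l] z 0 := by
    have h1 := ((H l z hz).norm.log (norm_ne_zero_iff.2 hC)).isBigO_one ℂ
    exact h1.trans_isLittleO (hz.one_isLittleO 0)
  have h3 : (fun a => ∑ i, (e i : ℝ) * Real.log ‖z i a‖) =o[l] z 0 :=
    IsLittleO.fun_sum fun i _ => (hlog i).const_mul_left _
  refine (h0.add h3).congr' ?_ EventuallyEq.rfl
  filter_upwards [eventually_all.2 hz.eventually_ne_zero, hz.eventually_aeval_ne_zero hP]
    with a ha hb
  have h2 : ∏ i, z i a ^ e i ≠ 0 := Finset.prod_ne_zero_iff.2 fun i _ => pow_ne_zero _ (ha i)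
  rw [norm_div, Real.log_div (norm_ne_zero_iff.2 hb) (norm_ne_zero_iff.2 h2), norm_prod,
    Real.log_prod fun i _ => norm_ne_zero_iff.2 (pow_ne_zero _ (ha i))]
  simp only [norm_pow, Real.log_pow]
  ring

/-! ### Asymptotics of iterated logarithms -/

/-- The iterated principal logarithms. -/
noncomputable def iterLog : ℕ → ℂ → ℂ
  | 0, u => u
  | r + 1, u => Complex.log (iterLog r u)

theorem tendsto_re_log {α : Type} {l : Filter α} {w : α → ℂ}
    (hw : Tendsto (fun a => ‖w a‖) l atTop) :
    Tendsto (fun a => (Complex.log (w a)).re) l atTop := by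
  simp only [Complex.log_re]
  exact Real.tendsto_log_atTop.comp hw

theorem tendsto_norm_log {α : Type} {l : Filter α} {w : α → ℂ}
    (hw : Tendsto (fun a => ‖w a‖) l atTop) :
    Tendsto (fun a => ‖Complex.log (w a)‖) l atTop :=
  tendsto_atTop_mono (fun _ => (le_abs_self _).trans (Complex.abs_re_le_norm _)) (tendsto_re_log hw)

theorem log_pow_isLittleO {α : Type} {l : Filter α} {w : α → ℂ}
    (hw : Tendsto (fun a => ‖w a‖) l atTop) (N : ℕ) :
    (fun a => Complex.log (w a) ^ N) =o[l] w := by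
  unfold Complex.log
  refine add_pow_isLittleO (fun N => ?_) (fun N => ?_) N
  · have h := ((Real.isLittleO_pow_log_id_atTop (n := N)).comp_tendsto hw)
    refine (IsLittleO.of_norm_norm ?_)
    have h2 := h.norm_norm
    refine h2.congr (fun a => ?_) (fun a => ?_)
    · simp
    · simp
  · have h1 : (fun _ => (1 : ℂ)) =o[l] w := isLittleO_const_left.2 (Or.inr hw)
    refine IsBigO.trans_isLittleO (IsBigO.of_bound (Real.pi ^ N) (Eventually.of_forall fun a => ?_))
      h1
    rw [norm_pow, norm_mul, Complex.norm_I, mul_one, norm_one, mul_one, Complex.norm_real]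
    gcongr
    exact Complex.abs_arg_le_pi _

theorem tendsto_norm_iterLog {α : Type} {l : Filter α} {u : α → ℂ}
    (hu : Tendsto (fun a => ‖u a‖) l atTop) (r : ℕ) :
    Tendsto (fun a => ‖iterLog r (u a)‖) l atTop := by
  induction r with
  | zero => exact hu
  | succ r ih => exact tendsto_norm_log ih

theorem isHierarchy_iterLog {α : Type} {l : Filter α} {u : α → ℂ}
    (hu : Tendsto (fun a => ‖u a‖) l atTop) (n : ℕ) :
    IsHierarchy l (fun (i : Fin n) a => iterLog i (u a)) := by
  refine ⟨fun i => isLittleO_const_left.2 (Or.inr (tendsto_norm_iterLog hu i)), ?_⟩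
  have key : ∀ i j : ℕ, ∀ N : ℕ, (fun a => iterLog (i + 1 + j) (u a) ^ N) =o[l]
      fun a => iterLog i (u a) := by
    intro i j
    induction j with
    | zero => exact fun N => log_pow_isLittleO (tendsto_norm_iterLog hu i) N
    | succ j ih =>
      intro N
      have h1 := log_pow_isLittleO (tendsto_norm_iterLog hu (i + 1 + j)) N
      have h2 := ih 1
      simp only [pow_one] at h2
      exact h1.trans h2
  intro i j hij N
  obtain ⟨d, hd⟩ := Nat.exists_eq_add_of_le (Nat.succ_le_of_lt hij)
  have := key i d N
  simp only [hd]
  exact this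

theorem eventually_iterLog_mem_slitPlane {α : Type} {l : Filter α} {u : α → ℂ}
    (hu : Tendsto (fun a => ‖u a‖) l atTop) (him : ∀ᶠ a in l, 0 < (u a).im) (r : ℕ) :
    ∀ᶠ a in l, iterLog r (u a) ∈ Complex.slitPlane := by
  cases r with
  | zero =>
    filter_upwards [him] with a ha
    exact Or.inr ha.ne'
  | succ r =>
    filter_upwards [(tendsto_re_log (tendsto_norm_iterLog hu r)).eventually_gt_atTop 0] with a ha
    exact Or.inl ha

/-- Write `u = w · (u/w)`. As `w` lies in the closed right half-plane and `u/w` in the open one, the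
arguments add without crossing the branch cut, so `log u - log w` tends to zero while `log w` is
unbounded. -/
theorem tendsto_log_div_log {α : Type} {l : Filter α} {u w : α → ℂ}
    (h : Tendsto (fun a => u a / w a) l (𝓝 1)) (hw : Tendsto (fun a => ‖w a‖) l atTop)
    (hre : ∀ᶠ a in l, 0 ≤ (w a).re) :
    Tendsto (fun a => Complex.log (u a) / Complex.log (w a)) l (𝓝 1) := by
  have h1 : Tendsto (fun a => Complex.log (u a / w a)) l (𝓝 0) := by
    have := h.clog (by simp)
    simpa using this
  have h2 : Tendsto (fun a => Complex.log (u a / w a) / Complex.log (w a)) l (𝓝 0) :=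
    ((h1.isBigO_one ℂ).trans_isLittleO
      (isLittleO_const_left.2 (Or.inr (tendsto_norm_log hw)))).tendsto_div_nhds_zero
  have h3 := h2.const_add 1
  rw [add_zero] at h3
  refine h3.congr' ?_
  have hq : ∀ᶠ a in l, 0 < (u a / w a).re :=
    (Complex.continuous_re.continuousAt.tendsto.comp h).eventually_const_lt (by simp)
  filter_upwards [hre, hq, hw.eventually_gt_atTop 0,
    (tendsto_norm_log hw).eventually_gt_atTop 0] with a ha hqa h0 hl
  have hw0 : w a ≠ 0 := norm_pos_iff.1 h0
  have hl0 : Complex.log (w a) ≠ 0 := norm_pos_iff.1 hl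
  have hq0 : u a / w a ≠ 0 := fun h => by simp [h] at hqa
  have e1 := abs_le.1 (Complex.abs_arg_le_pi_div_two_iff.2 ha)
  have e2 := abs_lt.1 (Complex.abs_arg_lt_pi_div_two_iff.2 (Or.inl hqa))
  have h4 : Complex.log (u a) = Complex.log (w a) + Complex.log (u a / w a) := by
    rw [← Complex.log_mul hw0 hq0 ⟨by linarith, by linarith⟩, mul_div_cancel₀ _ hw0]
  rw [h4, add_div, div_self hl0]

theorem tendsto_iterLog_div_iterLog {α : Type} {l : Filter α} {u w : α → ℂ}
    (h : Tendsto (fun a => u a / w a) l (𝓝 1)) (hw : Tendsto (fun a => ‖w a‖) l atTop)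
    (hre : ∀ᶠ a in l, 0 ≤ (w a).re) (r : ℕ) :
    Tendsto (fun a => iterLog r (u a) / iterLog r (w a)) l (𝓝 1) := by
  induction r with
  | zero => exact h
  | succ r ih =>
    refine tendsto_log_div_log ih (tendsto_norm_iterLog hw r) ?_
    cases r with
    | zero => exact hre
    | succ r => exact (tendsto_re_log (tendsto_norm_iterLog hw r)).eventually_ge_atTop 0

theorem iterExp_iterLog {u : ℂ} {r : ℕ} (h : ∀ i < r, iterLog i u ≠ 0) :
    ∀ i ≤ r, iterExp i (iterLog r u) = iterLog (r - i) u := by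
  intro i
  induction i with
  | zero => intro _; rfl
  | succ i ih =>
    intro hi
    rw [iterExp, ih (by omega), show r - i = r - (i + 1) + 1 by omega, iterLog,
      Complex.exp_log (h _ (by omega))]

theorem differentiableAt_iterLog {u : ℂ} {r : ℕ} (h : ∀ i < r, iterLog i u ∈ Complex.slitPlane) :
    DifferentiableAt ℂ (iterLog r) u := by
  induction r with
  | zero => exact differentiableAt_id
  | succ r ih => exact (ih fun i hi => h i (by omega)).clog (h r (by omega))

/-! ### Zeros of exponential polynomials with slowly varying coefficients -/

/-- Hurwitz's argument. On a small circle around `c`, `‖H‖` is at least some `m > 0`. If `F n` had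
no zero, the maximum principle for `1 / F n` would give `‖F n c‖ ≥ 3m/4`, whereas `F n c` is close
to `H c = 0`. -/
theorem exists_zero_of_tendsto {F : ℕ → ℂ → ℂ} {H : ℂ → ℂ} {c : ℂ} {R : ℝ} (hR : 0 < R)
    (hH : Continuous H) (hc : H c = 0) (hne : ∀ᶠ v in 𝓝[≠] c, H v ≠ 0)
    (hF : ∀ᶠ n in atTop, DifferentiableOn ℂ (F n) (Metric.closedBall c R))
    (hFH : Tendsto (fun a : ℕ × ℂ => F a.1 a.2 - H a.2) (atTop ×ˢ 𝓟 (Metric.closedBall c R))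
      (𝓝 0)) :
    ∀ᶠ n in atTop, ∃ v ∈ Metric.closedBall c R, F n v = 0 := by
  obtain ⟨ε, hε, hball⟩ := Metric.mem_nhdsWithin_iff.1 hne
  obtain ⟨r, hr0, hr⟩ := exists_between (lt_min hε hR)
  have hrε := hr.trans_le (min_le_left _ _)
  have hrR := hr.trans_le (min_le_right _ _)
  have hsph : ∀ v ∈ Metric.sphere c r, H v ≠ 0 := by
    intro v hv
    refine hball ⟨?_, ?_⟩
    · rw [Metric.mem_ball, Metric.mem_sphere.1 hv]
      exact hrε
    · exact Metric.ne_of_mem_sphere hv hr0.ne'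
  obtain ⟨v₀, hv₀, hmin⟩ := (isCompact_sphere c r).exists_isMinOn
    (NormedSpace.sphere_nonempty.2 hr0.le) hH.norm.continuousOn
  set m := ‖H v₀‖ with hm
  have hm0 : 0 < m := norm_pos_iff.2 (hsph v₀ hv₀)
  have h1 : ∀ᶠ a in (atTop : Filter ℕ) ×ˢ 𝓟 (Metric.closedBall c R),
      ‖F a.1 a.2 - H a.2‖ < m / 4 := by
    have := hFH.norm
    rw [norm_zero] at this
    exact this.eventually_lt_const (by positivity)
  rw [eventually_prod_principal_iff] at h1
  filter_upwards [h1, hF] with n hn hd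
  by_contra! hz
  have hsub : Metric.closedBall c r ⊆ Metric.closedBall c R :=
    Metric.closedBall_subset_closedBall hrR.le
  have hinv : DiffContOnCl ℂ (fun v => (F n v)⁻¹) (Metric.ball c r) := by
    refine DifferentiableOn.diffContOnCl ?_
    rw [closure_ball c hr0.ne']
    exact (hd.mono hsub).inv fun v hv => hz v (hsub hv)
  have hbd := Complex.norm_le_of_forall_mem_frontier_norm_le Metric.isBounded_ball hinv
    (C := (3 * m / 4)⁻¹) (fun v hv => by
      rw [frontier_ball c hr0.ne'] at hv
      have e1 := hn v (hsub (Metric.sphere_subset_closedBall hv))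
      have e2 : m ≤ ‖H v‖ := hmin hv
      have e3 := norm_sub_norm_le (H v) (F n v)
      rw [norm_sub_rev] at e3
      rw [norm_inv]
      exact inv_anti₀ (by positivity) (by linarith))
    (subset_closure (Metric.mem_ball_self hr0))
  have e1 := hn c (Metric.mem_closedBall_self hR.le)
  rw [hc, sub_zero] at e1
  rw [norm_inv] at hbd
  have e2 : 0 < ‖F n c‖ := norm_pos_iff.2 (hz c (Metric.mem_closedBall_self hR.le))
  rw [inv_le_inv₀ e2 (by positivity)] at hbd
  linarith

theorem differentiableAt_aeval {K : Type*} [Field K] [Algebra K ℂ] {σ : Type*}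
    {f : σ → ℂ → ℂ} {v : ℂ} (hf : ∀ i, DifferentiableAt ℂ (f i) v) (P : MvPolynomial σ K) :
    DifferentiableAt ℂ (fun v => MvPolynomial.aeval (fun i => f i v) P) v := by
  induction P using MvPolynomial.induction_on with
  | C c =>
    simp only [MvPolynomial.algHom_C]
    exact differentiableAt_const _
  | add p q hp hq =>
    simp only [map_add]
    exact hp.add hq
  | mul_X p i hp =>
    simp only [map_mul, MvPolynomial.aeval_X]
    exact hp.mul (hf i)

theorem exists_zero_one_add_sum {d : ℕ} {a : Fin d → ℂ} (ha : a ≠ 0) :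
    ∃ c : ℂ, 1 + ∑ j, a j * Complex.exp c ^ (j.1 + 1) = 0 ∧
      ∀ᶠ v in 𝓝[≠] c, 1 + ∑ j, a j * Complex.exp v ^ (j.1 + 1) ≠ 0 := by
  set B : Polynomial ℂ := 1 + ∑ j, Polynomial.C (a j) * Polynomial.X ^ (j.1 + 1) with hB
  have heval : ∀ y, B.eval y = 1 + ∑ j, a j * y ^ (j.1 + 1) := fun y => by
    simp [hB, Polynomial.eval_finsetSum]
  have hcoeff : ∀ j : Fin d, B.coeff (j.1 + 1) = a j := fun j => by
    simp [hB, Polynomial.finsetSum_coeff, Polynomial.coeff_X_pow, Polynomial.coeff_one,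
      Fin.val_inj]
  obtain ⟨j, hj⟩ := Function.ne_iff.1 ha
  have hdeg : B.degree ≠ 0 := fun h => by
    have h1 := Polynomial.coeff_eq_zero_of_degree_lt (p := B) (n := j.1 + 1)
      (by rw [h]; exact_mod_cast Nat.succ_pos _)
    rw [hcoeff] at h1
    exact hj h1
  have hB0 : B ≠ 0 := fun h => by
    have := hcoeff j
    rw [h, Polynomial.coeff_zero] at this
    exact hj this.symm
  obtain ⟨y, hy⟩ := IsAlgClosed.exists_root B hdeg
  -- The constant term is one, so the root has a logarithm.
  have hy0 : y ≠ 0 := by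
    rintro rfl
    rw [Polynomial.IsRoot, heval] at hy
    simp at hy
  refine ⟨Complex.log y, ?_, ?_⟩
  · rw [Complex.exp_log hy0, ← heval]
    exact hy
  · have h1 : ∀ᶠ x in 𝓝[≠] y, B.eval x ≠ 0 := by
      have hfin : ((B.roots.toFinset : Set ℂ) \ {y}).Finite :=
        (Finset.finite_toSet _).subset Set.sdiff_subset
      filter_upwards [nhdsWithin_le_nhds (hfin.isClosed.isOpen_compl.mem_nhds
        (show y ∈ ((B.roots.toFinset : Set ℂ) \ {y})ᶜ by simp)), self_mem_nhdsWithin] with x hx hxy h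
      exact hx ⟨by simpa [hB0] using h, hxy⟩
    have h2 := (Complex.hasDerivAt_exp (Complex.log y)).tendsto_nhdsNE (Complex.exp_ne_zero _)
    rw [Complex.exp_log hy0] at h2
    filter_upwards [h2.eventually h1] with v hv
    rwa [← heval]

/-- A Newton polygon choice: `ρ` is the largest real number with `‖c j · exp(jρ)‖ ≤ ‖c 0‖` for all
`j ∈ J`. Equality holds for some `j`, so the normalised coefficient vector has sup norm exactly one
and its limit points are nonzero. -/
theorem exists_shift {α : Type} {l : Filter α} {d : ℕ} {c : ℕ → α → ℂ} {w : α → ℂ} {J : Finset ℕ}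
    (hJ : J.Nonempty) (hJ0 : ∀ j ∈ J, 0 < j) (hJd : ∀ j ∈ J, j ≤ d)
    (hc : ∀ j, j ∉ J → 0 < j → ∀ a, c j a = 0)
    (hc0 : ∀ᶠ a in l, c 0 a ≠ 0) (hcJ : ∀ j ∈ J, ∀ᶠ a in l, c j a ≠ 0)
    (hlog0 : (fun a => Real.log ‖c 0 a‖) =o[l] w)
    (hlog : ∀ j ∈ J, (fun a => Real.log ‖c j a‖) =o[l] w) :
    ∃ ρ : α → ℝ, ρ =o[l] w ∧ ∀ᶠ a in l,
      (fun j : Fin d => c (j + 1) a * Complex.exp (ρ a) ^ (j.1 + 1) / c 0 a) ∈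
        Metric.sphere (0 : Fin d → ℂ) 1 := by
  let ρ : α → ℝ := fun a => J.inf' hJ fun j => (Real.log ‖c 0 a‖ - Real.log ‖c j a‖) / j
  refine ⟨ρ, ?_, ?_⟩
  · have h1 : (fun a => ∑ j ∈ J, ‖(j : ℝ)⁻¹ * (Real.log ‖c 0 a‖ - Real.log ‖c j a‖)‖) =o[l] w :=
      IsLittleO.fun_sum fun j hj => ((hlog0.sub (hlog j hj)).const_mul_left _).norm_left
    refine IsBigO.trans_isLittleO (IsBigO.of_norm_le fun a => ?_) h1
    obtain ⟨j, hj, e⟩ := J.exists_mem_eq_inf' hJ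
      fun j => (Real.log ‖c 0 a‖ - Real.log ‖c j a‖) / (j : ℝ)
    have e' : ρ a = (j : ℝ)⁻¹ * (Real.log ‖c 0 a‖ - Real.log ‖c j a‖) := by
      rw [inv_mul_eq_div]
      exact e
    rw [e']
    exact Finset.single_le_sum
      (f := fun j : ℕ => ‖(j : ℝ)⁻¹ * (Real.log ‖c 0 a‖ - Real.log ‖c j a‖)‖)
      (fun _ _ => norm_nonneg _) hj
  · filter_upwards [hc0, (Finset.eventually_all J).2 hcJ] with a h0 hJa
    have hexp : ∀ j ∈ J, ‖c j a * Complex.exp (ρ a) ^ j / c 0 a‖ =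
        Real.exp (j * (ρ a - (Real.log ‖c 0 a‖ - Real.log ‖c j a‖) / j)) := by
      intro j hj
      have hj0 : (j : ℝ) ≠ 0 := by exact_mod_cast (hJ0 j hj).ne'
      have e1 : (j : ℝ) * (ρ a - (Real.log ‖c 0 a‖ - Real.log ‖c j a‖) / j) =
          Real.log ‖c j a‖ + j * ρ a - Real.log ‖c 0 a‖ := by
        field_simp
        ring
      rw [e1, Real.exp_sub, Real.exp_add, Real.exp_log (norm_pos_iff.2 h0),
        Real.exp_log (norm_pos_iff.2 (hJa j hj)), norm_div, norm_mul, norm_pow, Complex.norm_exp,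
        Complex.ofReal_re, ← Real.exp_nat_mul]
    have hle : ∀ j ∈ J, ‖c j a * Complex.exp (ρ a) ^ j / c 0 a‖ ≤ 1 := by
      intro j hj
      rw [hexp j hj, Real.exp_le_one_iff]
      exact mul_nonpos_of_nonneg_of_nonpos (Nat.cast_nonneg _)
        (sub_nonpos.2 (Finset.inf'_le (fun j : ℕ => (Real.log ‖c 0 a‖ - Real.log ‖c j a‖) / j) hj))
    rw [mem_sphere_zero_iff_norm]
    apply le_antisymm
    · refine (pi_norm_le_iff_of_nonneg zero_le_one).2 fun j => ?_
      by_cases hj : j.1 + 1 ∈ J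
      · exact hle _ hj
      · simp [hc _ hj (Nat.succ_pos _) a]
    · obtain ⟨j, hj, e⟩ := J.exists_mem_eq_inf' hJ
        fun j => (Real.log ‖c 0 a‖ - Real.log ‖c j a‖) / (j : ℝ)
      have hj0 := hJ0 j hj
      have hjd := hJd j hj
      obtain ⟨i, rfl⟩ : ∃ i, j = i + 1 := ⟨j - 1, by omega⟩
      have h1 := hexp _ hj
      have e' : ρ a = (Real.log ‖c 0 a‖ - Real.log ‖c (i + 1) a‖) / ((i + 1 : ℕ) : ℝ) := e
      rw [← e', sub_self, mul_zero, Real.exp_zero] at h1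
      rw [← h1]
      exact norm_le_pi_norm
        (fun j : Fin d => c (j + 1) a * Complex.exp (ρ a) ^ (j.1 + 1) / c 0 a) ⟨i, by omega⟩

theorem exists_exp_iterLog_zero {K : Type*} [Field K] [Algebra K ℂ] {n : ℕ}
    (Q : Polynomial (MvPolynomial (Fin (n + 1)) K)) (hQ0 : Q.coeff 0 ≠ 0) (hQd : 0 < Q.natDegree)
    (S : Set (MvPolynomial (Fin (n + 1)) K)) (hS : S.Finite) (hS0 : ∀ P ∈ S, P ≠ 0) :
    ∃ u : ℂ, (∀ i < n + 1, iterLog i u ≠ 0) ∧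
      ∑ j ∈ Finset.range (Q.natDegree + 1),
        MvPolynomial.aeval (fun i : Fin (n + 1) => iterLog i u) (Q.coeff j) * Complex.exp u ^ j = 0 ∧
      ∀ P ∈ S, MvPolynomial.aeval (fun i : Fin (n + 1) => iterLog i u) P ≠ 0 := by
  set d := Q.natDegree with hd
  let c : ℕ → ℂ → ℂ := fun j u =>
    MvPolynomial.aeval (fun i : Fin (n + 1) => iterLog i u) (Q.coeff j)
  -- At these base points `exp` equals one, so the exponential sees only the shift and `v`.
  let W : ℕ → ℂ := fun m => (m * (2 * Real.pi * Complex.I) : ℂ)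
  have hWnorm : ∀ m, ‖W m‖ = m * (2 * Real.pi) := fun m => by
    simp [W, abs_of_pos Real.pi_pos]
  have hW : Tendsto (fun m => ‖W m‖) atTop atTop := by
    simp only [hWnorm]
    exact tendsto_natCast_atTop_atTop.atTop_mul_const (by positivity)
  have hWre : ∀ m, (W m).re = 0 := fun m => by simp [W]
  have hWim : ∀ m, (W m).im = m * (2 * Real.pi) := fun m => by simp [W]
  have hWexp : ∀ m, Complex.exp (W m) = 1 := fun m => Complex.exp_nat_mul_two_pi_mul_I m
  have hzW := isHierarchy_iterLog hW (n + 1)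
  let J : Finset ℕ := Q.support.erase 0
  have hmem : ∀ j, j ∈ J ↔ 0 < j ∧ Q.coeff j ≠ 0 := fun j => by
    simp [J, Nat.pos_iff_ne_zero]
  have hdJ : d ∈ J := (hmem d).2 ⟨hQd, by
    rw [hd, Polynomial.coeff_natDegree, Ne, Polynomial.leadingCoeff_eq_zero]
    rintro rfl
    simp at hQ0⟩
  obtain ⟨ρ, hρ, hsph⟩ := exists_shift (l := atTop) (d := d) (c := fun j m => c j (W m)) (w := W)
    (J := J) ⟨d, hdJ⟩ (fun j hj => ((hmem j).1 hj).1)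
    (fun j hj => Polynomial.le_natDegree_of_ne_zero ((hmem j).1 hj).2)
    (fun j hj hj0 m => by
      have : Q.coeff j = 0 := by
        by_contra h
        exact hj ((hmem j).2 ⟨hj0, h⟩)
      simp [c, this])
    (hzW.eventually_aeval_ne_zero hQ0)
    (fun j hj => hzW.eventually_aeval_ne_zero ((hmem j).1 hj).2)
    (hzW.log_norm_aeval_isLittleO hQ0)
    (fun j hj => hzW.log_norm_aeval_isLittleO ((hmem j).1 hj).2)
  obtain ⟨a, ha, φ, hφ, hlim⟩ :=
    (isCompact_sphere (0 : Fin d → ℂ) 1).tendsto_subseq' hsph.frequently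
  have ha0 : a ≠ 0 := by
    rintro rfl
    simp at ha
  obtain ⟨v₀, hv₀, hne⟩ := exists_zero_one_add_sum ha0
  -- Limits along this filter are limits in the index that are uniform for `v` in the closed ball.
  let l : Filter (ℕ × ℂ) := atTop ×ˢ 𝓟 (Metric.closedBall v₀ 1)
  have hφl : Tendsto (fun x : ℕ × ℂ => φ x.1) l atTop := hφ.tendsto_atTop.comp tendsto_fst
  let U : ℕ → ℂ → ℂ := fun m v => W (φ m) + ρ (φ m) + v
  have hw : Tendsto (fun x : ℕ × ℂ => ‖W (φ x.1)‖) l atTop := hW.comp hφl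
  have hbdd : ∀ᶠ x in l, ‖x.2‖ ≤ ‖v₀‖ + 1 := by
    have : ∀ᶠ x in l, x.2 ∈ Metric.closedBall v₀ 1 := tendsto_snd.eventually (mem_principal_self _)
    filter_upwards [this] with x hx
    have h1 := norm_sub_norm_le x.2 v₀
    rw [mem_closedBall_iff_norm] at hx
    linarith
  have hvo : (fun x : ℕ × ℂ => x.2) =o[l] fun x => W (φ x.1) := by
    refine IsBigO.trans_isLittleO (g := fun _ => (1 : ℂ)) (IsBigO.of_bound (‖v₀‖ + 1) ?_)
      (isLittleO_const_left.2 (Or.inr hw))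
    simpa using hbdd
  have hρo : (fun x : ℕ × ℂ => (ρ (φ x.1) : ℂ)) =o[l] fun x => W (φ x.1) := by
    refine IsLittleO.of_norm_left ?_
    simp only [Complex.norm_real]
    exact (hρ.comp_tendsto hφl).norm_left
  have hUW : Tendsto (fun x : ℕ × ℂ => U x.1 x.2 / W (φ x.1)) l (𝓝 1) := by
    have h1 := ((hρo.add hvo).tendsto_div_nhds_zero).const_add 1
    rw [add_zero] at h1
    refine h1.congr' ?_
    filter_upwards [hw.eventually_gt_atTop 0] with x hx
    have hx0 : W (φ x.1) ≠ 0 := norm_pos_iff.1 hx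
    simp only [U]
    rw [add_assoc, add_div (W (φ x.1)), div_self hx0]
  have hUnorm : Tendsto (fun x : ℕ × ℂ => ‖U x.1 x.2‖) l atTop := by
    have h1 := (hUW.norm.pos_mul_atTop (by simp) hw)
    refine h1.congr' ?_
    filter_upwards [hw.eventually_gt_atTop 0] with x hx
    rw [norm_div, div_mul_cancel₀ _ hx.ne']
  -- `W` is on the positive imaginary axis and `U / W` tends to one, so `U` enters the upper
  -- half-plane and avoids the cut.
  have hUim : ∀ᶠ x in l, 0 < (U x.1 x.2).im := by
    have h1 : ∀ᶠ x in l, 0 < (U x.1 x.2 / W (φ x.1)).re :=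
      (Complex.continuous_re.continuousAt.tendsto.comp hUW).eventually_const_lt (by simp)
    filter_upwards [h1, hw.eventually_gt_atTop 0] with x hx hx0
    have hx1 : W (φ x.1) ≠ 0 := norm_pos_iff.1 hx0
    have h2 : U x.1 x.2 = U x.1 x.2 / W (φ x.1) * W (φ x.1) := by rw [div_mul_cancel₀ _ hx1]
    rw [h2, Complex.mul_im, hWre, hWim, mul_zero, add_zero]
    rw [hWnorm] at hx0
    exact mul_pos hx hx0
  have hzU := isHierarchy_iterLog hUnorm (n + 1)
  have hzw := isHierarchy_iterLog hw (n + 1)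
  have hratio : ∀ P : MvPolynomial (Fin (n + 1)) K, P ≠ 0 → Tendsto (fun x : ℕ × ℂ =>
      MvPolynomial.aeval (fun i : Fin (n + 1) => iterLog i (U x.1 x.2)) P /
        MvPolynomial.aeval (fun i : Fin (n + 1) => iterLog i (W (φ x.1))) P) l (𝓝 1) :=
    fun P hP => tendsto_aeval_div_aeval hP hzU hzw fun i =>
      tendsto_iterLog_div_iterLog hUW hw (Eventually.of_forall fun x => (hWre _).ge) i
  have hslit : ∀ᶠ x in l, ∀ i < n + 1, iterLog i (U x.1 x.2) ∈ Complex.slitPlane := by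
    have := (Finset.eventually_all (Finset.range (n + 1))).2
      fun i _ => eventually_iterLog_mem_slitPlane hUnorm hUim i
    filter_upwards [this] with x hx i hi
    exact hx i (Finset.mem_range.2 hi)
  have hSev : ∀ᶠ x in l, ∀ P ∈ S,
      MvPolynomial.aeval (fun i : Fin (n + 1) => iterLog i (U x.1 x.2)) P ≠ 0 :=
    (eventually_all_finite hS).2 fun P hP => hzU.eventually_aeval_ne_zero (hS0 P hP)
  have hcW : ∀ P : MvPolynomial (Fin (n + 1)) K, P ≠ 0 → ∀ᶠ x in l,
      MvPolynomial.aeval (fun i : Fin (n + 1) => iterLog i (W (φ x.1))) P ≠ 0 := fun P hP =>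
    hzw.eventually_aeval_ne_zero hP
  let F : ℕ → ℂ → ℂ := fun m v =>
    (∑ j ∈ Finset.range (d + 1), c j (U m v) * Complex.exp (U m v) ^ j) / c 0 (W (φ m))
  have hFd : ∀ᶠ m in atTop, DifferentiableOn ℂ (F m) (Metric.closedBall v₀ 1) := by
    filter_upwards [eventually_prod_principal_iff.1 hslit] with m hm v hv
    refine DifferentiableAt.differentiableWithinAt ?_
    have hU : DifferentiableAt ℂ (U m) v := differentiableAt_id.const_add _
    refine DifferentiableAt.div_const (DifferentiableAt.fun_sum fun j _ => ?_) _
    refine DifferentiableAt.mul ?_ (hU.cexp.pow _)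
    refine differentiableAt_aeval (f := fun (i : Fin (n + 1)) v => iterLog i (U m v))
      (fun i => ?_) (Q.coeff j)
    exact (differentiableAt_iterLog fun k hk => hm v hv k (hk.trans i.2)).comp v hU
  have hFH : Tendsto (fun x : ℕ × ℂ =>
      F x.1 x.2 - (1 + ∑ j, a j * Complex.exp x.2 ^ (j.1 + 1))) l (𝓝 0) := by
    let b : Fin d → ℕ × ℂ → ℂ := fun j x =>
      c (j + 1) (W (φ x.1)) * Complex.exp (ρ (φ x.1)) ^ (j.1 + 1) / c 0 (W (φ x.1))
    have hb : ∀ j, Tendsto (b j) l (𝓝 (a j)) := fun j =>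
      ((tendsto_pi_nhds.1 hlim) j).comp tendsto_fst
    have hq : ∀ j : Fin d, ∃ q : ℕ × ℂ → ℂ, Tendsto q l (𝓝 1) ∧
        ∀ᶠ x in l, c (j + 1) (U x.1 x.2) = q x * c (j + 1) (W (φ x.1)) := by
      intro j
      by_cases hj : Q.coeff (j + 1) = 0
      · exact ⟨fun _ => 1, tendsto_const_nhds, Eventually.of_forall fun x => by simp [c, hj]⟩
      · refine ⟨_, hratio _ hj, ?_⟩
        filter_upwards [hcW _ hj] with x hx
        exact (div_mul_cancel₀ _ hx).symm
    choose q hq1 hq2 using hq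
    have hexp : ∀ j : Fin d,
        IsBoundedUnder (· ≤ ·) l (norm ∘ fun x : ℕ × ℂ => Complex.exp x.2 ^ (j.1 + 1)) := by
      intro j
      refine ⟨Real.exp (‖v₀‖ + 1) ^ (j.1 + 1), eventually_map.2 ?_⟩
      filter_upwards [hbdd] with x hx
      rw [Function.comp_apply, norm_pow, Complex.norm_exp]
      gcongr
      exact (Complex.re_le_norm _).trans hx
    have h1 : Tendsto (fun x : ℕ × ℂ => (c 0 (U x.1 x.2) / c 0 (W (φ x.1)) - 1) +
        ∑ j : Fin d, (q j x * b j x - a j) * Complex.exp x.2 ^ (j.1 + 1)) l (𝓝 0) := by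
      have e0 := (hratio _ hQ0).sub_const 1
      have e1 := tendsto_finsetSum (Finset.univ : Finset (Fin d)) fun j _ =>
        Tendsto.zero_mul_isBoundedUnder_le (f := fun x => q j x * b j x - a j)
          (by simpa using ((hq1 j).mul (hb j)).sub_const (a j)) (hexp j)
      simpa using e0.add e1
    refine h1.congr' ?_
    filter_upwards [eventually_all.2 hq2] with x hx
    have hU : Complex.exp (U x.1 x.2) = Complex.exp (ρ (φ x.1)) * Complex.exp x.2 := by
      simp only [U, Complex.exp_add, hWexp, one_mul]
    simp only [F]
    rw [Finset.sum_range_succ', pow_zero, mul_one, add_div, ← Fin.sum_univ_eq_sum_range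
      (fun j => c (j + 1) (U x.1 x.2) * Complex.exp (U x.1 x.2) ^ (j + 1)), Finset.sum_div,
      add_comm _ (c 0 _ / _), add_sub_add_comm, ← Finset.sum_sub_distrib]
    congr 1
    refine Finset.sum_congr rfl fun j _ => ?_
    rw [hx j, hU, mul_pow]
    simp only [b]
    ring
  have hcont : Continuous fun v : ℂ => 1 + ∑ j, a j * Complex.exp v ^ (j.1 + 1) := by fun_prop
  have hzero := exists_zero_of_tendsto one_pos hcont hv₀ hne hFd hFH
  obtain ⟨m, ⟨v, hv, hm0⟩, hm1, hm2, hm3⟩ := (hzero.and ((eventually_prod_principal_iff.1 hslit).and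
    ((eventually_prod_principal_iff.1 hSev).and
    (eventually_prod_principal_iff.1 (hcW _ hQ0))))).exists
  refine ⟨U m v, fun i hi => Complex.slitPlane_ne_zero (hm1 v hv i hi), ?_, hm2 v hv⟩
  exact (div_eq_zero_iff.1 hm0).resolve_right (hm3 v hv)

/-! ### Irreducible polynomials and linear elimination -/

open MvPolynomial in
theorem degreeOf_ne_zero_iff_mem_vars {R σ : Type*} [CommSemiring R] {p : MvPolynomial σ R}
    {i : σ} : degreeOf i p ≠ 0 ↔ i ∈ p.vars := by
  classical
  rw [degreeOf_def, vars_def, Multiset.mem_toFinset, Multiset.count_ne_zero]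

open MvPolynomial in
theorem Irreducible.degreeOf_eq_zero_of_dvd {K σ : Type*} [Field K] {p g : MvPolynomial σ K}
    (hp : Irreducible p) (hg : ¬IsUnit g) (hgp : g ∣ p) {i : σ} (hi : degreeOf i g = 0) :
    degreeOf i p = 0 := by
  obtain ⟨r, rfl⟩ := hgp
  obtain ⟨c, -, rfl⟩ := isUnit_iff_eq_C_of_isReduced.1 ((hp.isUnit_or_isUnit rfl).resolve_left hg)
  have h := degreeOf_mul_le i g (C c)
  rw [hi, degreeOf_C] at h
  omega

open MvPolynomial in
theorem X_sub_dvd_of_aeval_update_eq_zero {R σ : Type*} [CommRing R] [DecidableEq σ]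
    {p h : MvPolynomial σ R} {j : σ} (hp : aeval (Function.update X j h) p = 0) : X j - h ∣ p := by
  rw [← Ideal.mem_span_singleton, ← Ideal.Quotient.eq_zero_iff_mem]
  have key : (Ideal.Quotient.mkₐ R (Ideal.span {X j - h})).comp (aeval (Function.update X j h)) =
      Ideal.Quotient.mkₐ R (Ideal.span {X j - h}) := by
    refine algHom_ext fun i => ?_
    simp only [AlgHom.comp_apply, aeval_X, Ideal.Quotient.mkₐ_eq_mk]
    rcases eq_or_ne i j with rfl | hij
    · rw [Function.update_self, eq_comm, Ideal.Quotient.eq]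
      exact Ideal.mem_span_singleton_self _
    · rw [Function.update_of_ne hij]
  have := DFunLike.congr_fun key p
  rw [AlgHom.comp_apply, hp, map_zero] at this
  exact this.symm

open MvPolynomial in
theorem totalDegree_aeval_le_of_le_one {R σ τ : Type*} [CommSemiring R]
    {f : σ → MvPolynomial τ R} (hf : ∀ i, (f i).totalDegree ≤ 1) (p : MvPolynomial σ R) :
    (aeval f p).totalDegree ≤ p.totalDegree := by
  rw [aeval_def, eval₂_eq]
  refine (totalDegree_finsetSum _ _).trans (Finset.sup_le fun d hd => ?_)
  refine (totalDegree_mul _ _).trans ?_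
  rw [algebraMap_eq, totalDegree_C, zero_add]
  refine (totalDegree_finsetProd _ _).trans ?_
  refine le_trans (Finset.sum_le_sum fun i _ => (totalDegree_pow _ _).trans
    (Nat.mul_le_mul_left _ (hf i))) ?_
  simp only [mul_one]
  exact le_totalDegree hd

-- Solve the linear relation for `x j` and substitute into `p`. If the result were zero, the linear
-- form `X j - h` would divide the irreducible `p`; but the form does not involve `i₀`, which occurs
-- in `p`.
open MvPolynomial in
theorem exists_eliminant {K : Type*} [Field K] [Algebra K ℂ] {k : ℕ}
    {p : MvPolynomial (Fin (k + 1)) K} (hp : Irreducible p) {i₀ j : Fin (k + 1)}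
    (hi₀ : i₀ ∈ p.vars) {m : Fin (k + 1) → K} (hj : m j ≠ 0) (hm : m i₀ = 0)
    {x : Fin (k + 1) → ℂ} (hx : ∑ i, algebraMap K ℂ (m i) * x i = 0) (hpx : aeval x p = 0) :
    ∃ g : MvPolynomial (Fin k) K, g ≠ 0 ∧ aeval (fun t => x (j.succAbove t)) g = 0 ∧
      g.totalDegree ≤ p.totalDegree := by
  let h : MvPolynomial (Fin k) K := ∑ t, C (-(m (j.succAbove t) / m j)) * X t
  have hjK : algebraMap K ℂ (m j) ≠ 0 := by simpa using hj
  have hh : aeval (fun t => x (j.succAbove t)) h = x j := by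
    rw [Fin.sum_univ_succAbove _ j] at hx
    simp only [h, map_sum, map_mul, algHom_C, aeval_X, map_neg, map_div₀]
    rw [eq_comm, ← mul_right_inj' hjK, eq_neg_of_add_eq_zero_left hx, Finset.mul_sum,
      ← Finset.sum_neg_distrib]
    refine Finset.sum_congr rfl fun t _ => ?_
    field_simp
  have hdeg : h.totalDegree ≤ 1 := by
    refine totalDegree_finsetSum_le fun t _ => ?_
    exact (totalDegree_mul _ _).trans (by simp)
  refine ⟨aeval (Fin.insertNth j h X : Fin (k + 1) → MvPolynomial (Fin k) K) p, ?_, ?_,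
    totalDegree_aeval_le_of_le_one (fun i => ?_) p⟩
  · intro h0
    have e1 : (rename j.succAbove).comp
        (aeval (Fin.insertNth j h X : Fin (k + 1) → MvPolynomial (Fin k) K)) =
        aeval (Function.update X j (rename j.succAbove h)) := by
      refine algHom_ext fun i => ?_
      refine j.succAboveCases ?_ (fun t => ?_) i
      · simp
      · simp [Fin.succAbove_ne]
    have e2 := DFunLike.congr_fun e1 p
    rw [AlgHom.comp_apply, h0, map_zero] at e2
    have hdvd := X_sub_dvd_of_aeval_update_eq_zero e2.symm
    refine degreeOf_ne_zero_iff_mem_vars.2 hi₀ (hp.degreeOf_eq_zero_of_dvd (fun hu => ?_) hdvd ?_)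
    · have := hu.map (aeval x : MvPolynomial (Fin (k + 1)) K →ₐ[K] ℂ)
      rw [map_sub, aeval_X, aeval_rename] at this
      change IsUnit (x j - aeval (fun t => x (j.succAbove t)) h) at this
      rw [hh, sub_self] at this
      simp at this
    · have hne : i₀ ≠ j := by
        rintro rfl
        exact hj hm
      rw [sub_eq_add_neg, ← Nat.le_zero]
      refine (degreeOf_add_le _ _ _).trans (max_le (degreeOf_X_of_ne hne).le ?_)
      rw [← neg_one_mul, ← C_1, ← C_neg]
      refine (degreeOf_C_mul_le _ _ _).trans ?_
      simp only [h, map_sum, map_mul, rename_C, rename_X]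
      refine (degreeOf_sum_le _ _ _).trans (Finset.sup_le fun t _ => ?_)
      by_cases ht : j.succAbove t = i₀
      · simp [ht, hm]
      · exact (degreeOf_C_mul_le _ _ _).trans (degreeOf_X_of_ne (Ne.symm ht)).le
  · have e1 : (aeval (fun t => x (j.succAbove t)) : MvPolynomial (Fin k) K →ₐ[K] ℂ).comp
        (aeval (Fin.insertNth j h X : Fin (k + 1) → MvPolynomial (Fin k) K)) = aeval x := by
      refine algHom_ext fun i => ?_
      refine j.succAboveCases ?_ (fun t => ?_) i
      · simp [hh]
      · simp
    rw [← hpx, ← e1, AlgHom.comp_apply]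
  · refine j.succAboveCases ?_ (fun t => ?_) i
    · simpa using hdeg
    · simp

/-! ### Zeros avoiding bounded linear relations -/

open MvPolynomial in
theorem exists_iterExp_zero_avoiding {K : Type*} [Field K] [Algebra K ℂ] {n : ℕ}
    {p : MvPolynomial (Fin (n + 2)) K} (hp : Irreducible p) (hp_first : 0 ∈ p.vars)
    (hp_last : Fin.last (n + 1) ∈ p.vars) (D : ℕ) :
    ∃ a : ℂ, aeval (fun i : Fin (n + 2) => iterExp i a) p = 0 ∧
      ∀ v : Fin (n + 1) → ℤ, v ≠ 0 → (∀ i, |v i| ≤ D) →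
        ∑ i, (v i : ℂ) * iterExp i a ≠ 0 := by
  have hchar : CharZero K := (algebraMap K ℂ).charZero
  -- With `u = e_n(a)`, the value `e_i(a)` is the logarithm of `u` iterated `n - i` times. Reversing
  -- the variables puts `exp u` in position zero.
  let q := rename Fin.rev p
  let Q := finSuccEquiv K (n + 1) q
  have hqdeg : ∀ i, degreeOf (Fin.rev i) q = degreeOf i p := fun i =>
    degreeOf_rename_of_injective Fin.rev_injective i
  have hq : Irreducible q :=
    (MulEquiv.irreducible_iff (renameEquiv K (Fin.revPerm (n := n + 2))).toMulEquiv).2 hp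
  have hQd : 0 < Q.natDegree := by
    rw [natDegree_finSuccEquiv, Nat.pos_iff_ne_zero, ← Fin.rev_last, hqdeg]
    exact degreeOf_ne_zero_iff_mem_vars.2 hp_last
  -- Otherwise `q` would be a constant multiple of `X 0`, and the first variable of `p` would not
  -- occur.
  have hQ0 : Q.coeff 0 ≠ 0 := by
    intro h
    have h1 : (X 0 : MvPolynomial (Fin (n + 2)) K) ∣ q := by
      rw [← map_dvd_iff (finSuccEquiv K (n + 1)), finSuccEquiv_X_zero]
      exact Polynomial.X_dvd_iff.2 h
    have h2 := hq.degreeOf_eq_zero_of_dvd (i := Fin.rev 0) X_prime.not_isUnit h1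
      (degreeOf_X_of_ne (by simp))
    rw [hqdeg] at h2
    exact degreeOf_ne_zero_iff_mem_vars.2 hp_first h2
  let L : (Fin (n + 1) → ℤ) → MvPolynomial (Fin (n + 1)) K := fun v =>
    ∑ i, C (v i : K) * X (Fin.rev i)
  let V : Set (Fin (n + 1) → ℤ) := {v | v ≠ 0 ∧ ∀ i, |v i| ≤ D}
  have hV : V.Finite := (Set.finite_Icc (fun _ => -(D : ℤ)) (fun _ => (D : ℤ))).subset
    fun v hv => ⟨fun i => (abs_le.1 (hv.2 i)).1, fun i => (abs_le.1 (hv.2 i)).2⟩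
  have hL : ∀ P ∈ L '' V, P ≠ 0 := by
    rintro _ ⟨v, hv, rfl⟩ h
    obtain ⟨i, hi⟩ := Function.ne_iff.1 hv.1
    have := congrArg (coeff (Finsupp.single (Fin.rev i) 1)) h
    simp only [L, coeff_sum, coeff_C_mul, coeff_X, coeff_zero] at this
    rw [Finset.sum_eq_single i] at this
    · simp at this
      exact hi this
    · intro b _ hb
      simp [Finsupp.single_left_inj, hb]
    · simp
  obtain ⟨u, hu1, hu2, hu3⟩ := exists_exp_iterLog_zero Q hQ0 hQd (L '' V) (hV.image L) hL
  have hE : ∀ i ≤ n, iterExp i (iterLog n u) = iterLog (n - i) u :=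
    iterExp_iterLog fun i hi => hu1 i (by omega)
  refine ⟨iterLog n u, ?_, fun v hv hvD h => hu3 (L v) ⟨v, ⟨hv, hvD⟩, rfl⟩ ?_⟩
  · have e1 : aeval (fun i : Fin (n + 2) => iterExp i (iterLog n u)) p =
        aeval (fun i : Fin (n + 2) => iterExp (Fin.rev i) (iterLog n u)) q := by
      rw [aeval_rename]
      congr 2
      funext i
      simp only [Function.comp_apply, Fin.rev_rev]
    rw [e1, aeval_eq_sum_finSuccEquiv, ← hu2]
    refine Finset.sum_congr rfl fun j _ => ?_
    congr 2
    · congr 2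
      funext i
      rw [hE _ (by rw [Fin.rev_succ]; exact Nat.le_of_lt_succ (Fin.rev i).2)]
      congr 1
      simp [Fin.rev_succ, Fin.val_rev]
      omega
    · rw [Fin.rev_zero, Fin.val_last, iterExp, hE n le_rfl, Nat.sub_self]
      rfl
  · rw [← h]
    simp only [L, map_sum, map_mul, algHom_C, aeval_X]
    refine Finset.sum_congr rfl fun i _ => ?_
    rw [hE i (Nat.le_of_lt_succ i.2), Fin.val_rev]
    simp

/-! ### Transcendence degree and integer relations -/

-- The generated field is algebraic over the generated ring, so some subfamily is a transcendence
-- basis; by cardinality it is the whole finite family.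
open IntermediateField in
theorem algebraicIndependent_of_card_le_trdeg.{u, v, w} {F : Type u} {E : Type v} [Field F]
    [Field E] [Algebra F E] {κ : Type w} [Finite κ] {η : κ → E}
    (h : Cardinal.lift.{v} (Cardinal.mk κ) ≤
      Cardinal.lift.{w} (Algebra.trdeg F (adjoin F (Set.range η)))) :
    AlgebraicIndependent F η := by
  let η' : κ → adjoin F (Set.range η) := fun i => ⟨η i, subset_adjoin _ _ ⟨i, rfl⟩⟩
  have hmem : ∀ y ∈ Algebra.adjoin F (Set.range η), ∀ z : adjoin F (Set.range η), z.1 = y →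
      z ∈ Algebra.adjoin F (Set.range η') := by
    intro y hy z hz
    have h1 : (Algebra.adjoin F (Set.range η')).map (adjoin F (Set.range η)).val =
        Algebra.adjoin F (Set.range η) := by
      rw [AlgHom.map_adjoin, ← Set.range_comp]
      rfl
    rw [← h1] at hy
    obtain ⟨w, hw, hwy⟩ := hy
    have : w = z := Subtype.ext (hwy.trans hz.symm)
    exact this ▸ hw
  have halg : Algebra.IsAlgebraic (Algebra.adjoin F (Set.range η')) (adjoin F (Set.range η)) := by
    refine ⟨fun z => ?_⟩
    obtain ⟨r, hr, s, hs, hz⟩ := mem_adjoin_iff_div.1 z.2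
    have hE : Algebra.adjoin F (Set.range η) ≤ (adjoin F (Set.range η)).toSubalgebra :=
      algebra_adjoin_le_adjoin _ _
    have e : z = (⟨r, hE hr⟩ : adjoin F (Set.range η)) / ⟨s, hE hs⟩ := Subtype.ext hz
    rw [e, div_eq_mul_inv]
    exact (isAlgebraic_algebraMap (⟨_, hmem r hr ⟨r, hE hr⟩ rfl⟩ :
      Algebra.adjoin F (Set.range η'))).mul (isAlgebraic_algebraMap
      (⟨_, hmem s hs ⟨s, hE hs⟩ rfl⟩ : Algebra.adjoin F (Set.range η'))).inv
  have hb := Algebra.IsAlgebraic.isTranscendenceBasis_of_lift_le_trdeg_of_finite F η' h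
  exact hb.1.map' (f := (adjoin F (Set.range η)).val) Subtype.val_injective

open IntermediateField in
theorem tdQ_le_of_subset_adjoin {S T : Set ℂ} (h : S ⊆ adjoin ℚ T) : tdQ S ≤ tdQ T :=
  have hle : adjoin ℚ S ≤ adjoin ℚ T := adjoin_le_iff.2 h
  trdeg_le_of_injective (inclusion hle) (inclusion_injective hle)

theorem tdQ_mono {S T : Set ℂ} (h : S ⊆ T) : tdQ S ≤ tdQ T :=
  tdQ_le_of_subset_adjoin (h.trans (IntermediateField.subset_adjoin ℚ T))

theorem SchanuelConjecture.exists_int_relation (hSC : SchanuelConjecture) {n : ℕ} {l : Fin n → ℂ}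
    {T : Set ℂ} (hl : ∀ i, l i ∈ T) (hexp : ∀ i, Complex.exp (l i) ∈ T) (hT : tdQ T < n) :
    ∃ m : Fin n → ℤ, m ≠ 0 ∧ ∑ i, (m i : ℂ) * l i = 0 := by
  have hdep : ¬ LinearIndependent ℤ l := by
    intro h
    rw [LinearIndependent.iff_fractionRing ℤ ℚ] at h
    have h1 : Set.range l ∪ (Set.range fun i => Complex.exp (l i)) ⊆ T := by
      rintro _ (⟨i, rfl⟩ | ⟨i, rfl⟩)
      · exact hl i
      · exact hexp i
    exact absurd ((hSC n l h).trans (tdQ_mono h1)) (not_le.2 hT)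
  obtain ⟨m, hm, i, hi⟩ := Fintype.not_linearIndependent_iff.1 hdep
  exact ⟨m, fun h => hi (congrFun h i), by simpa using hm⟩

theorem tdQ_eq_zero {T : Set ℂ} (h : ∀ x ∈ T, IsAlgebraic ℚ x) : tdQ T = 0 := by
  have : Algebra.IsAlgebraic ℚ (IntermediateField.adjoin ℚ T) :=
    IntermediateField.isAlgebraic_adjoin fun x hx => (h x hx).isIntegral
  exact trdeg_eq_zero

/-! ### Generic points of subtori and bounded relations -/

open MvPolynomial in
/-- A non-zero polynomial vanishing at a point of a subtorus of codimension one, generic in that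
subtorus, has two distinct monomials which agree on the subtorus. -/
theorem exists_proportional_exponent {ι : Type} [Fintype ι] [DecidableEq ι] {l : ι → ℂ}
    {m : ι → ℤ} {s : ι} (hs : m s ≠ 0) (hm : ∑ t, (m t : ℂ) * l t = 0)
    {g : MvPolynomial ι QAlg} (hg : g ≠ 0) (hgl : aeval (fun t => Complex.exp (l t)) g = 0)
    {S : Set ℂ} (hS : S ⊆ IntermediateField.adjoin ℚ (Set.range fun t => Complex.exp (l t)))
    (htd : ((Fintype.card ι - 1 : ℕ) : Cardinal) ≤ tdQ S) :
    ∃ v : ι → ℤ, v ≠ 0 ∧ (∀ t, |v t| ≤ g.totalDegree) ∧ ∀ t, m s * v t = v s * m t := by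
  have hs' : (m s : ℂ) ≠ 0 := by exact_mod_cast hs
  -- Coordinates on the subtorus: dividing by `m s` makes every `exp (l t)`, including `t = s`, a
  -- monomial in the `η` with integer exponents.
  let η : {t // t ≠ s} → ℂ := fun t => Complex.exp (l t / m s)
  have hsum : ∀ c : ι → ℂ, ∑ t, c t * l t = ∑ t : {t // t ≠ s}, (m s * c t - m t * c s) *
      (l t / m s) := by
    intro c
    have e1 : ∑ t, c t * l t = ∑ t, (m s * c t - m t * c s) * (l t / m s) := by
      have : ∑ t, (m s * c t - m t * c s) * (l t / m s) =
          ∑ t, (c t * l t - c s / m s * (m t * l t)) := by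
        refine Finset.sum_congr rfl fun t _ => ?_
        field_simp
      rw [this, Finset.sum_sub_distrib, ← Finset.mul_sum, hm, mul_zero, sub_zero]
    rw [e1, ← Finset.sum_erase_add _ _ (Finset.mem_univ s), mul_comm (m s : ℂ) (c s),
      mul_comm (c s) (m s : ℂ), sub_self, zero_mul, add_zero]
    refine (Finset.sum_subtype _ (fun t => ?_) _)
    simp
  have hηexp : ∀ c : {t // t ≠ s} → ℤ,
      Complex.exp (∑ t : {t // t ≠ s}, (c t : ℂ) * (l t / m s)) = ∏ t, η t ^ c t := by
    intro c
    rw [Complex.exp_sum]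
    exact Finset.prod_congr rfl fun t _ => Complex.exp_int_mul _ _
  have hind : AlgebraicIndependent ℚ η := by
    have hadj : (IntermediateField.adjoin ℚ (Set.range fun t => Complex.exp (l t)) : Set ℂ) ⊆
        IntermediateField.adjoin ℚ (Set.range η) := by
      refine (IntermediateField.adjoin_le_iff (F := ℚ)).2 ?_
      rintro _ ⟨i, rfl⟩
      have h1 := hsum (fun t => if t = i then 1 else 0)
      simp only [ite_mul, one_mul, zero_mul, Finset.sum_ite_eq', Finset.mem_univ, if_true] at h1
      have h2 := hηexp fun t => m s * (if t.1 = i then 1 else 0) - m t * (if s = i then 1 else 0)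
      push_cast at h2
      have hmem : ∀ t, η t ∈ IntermediateField.adjoin ℚ (Set.range η) := fun t =>
        IntermediateField.subset_adjoin _ _ ⟨t, rfl⟩
      change Complex.exp (l i) ∈ IntermediateField.adjoin ℚ (Set.range η)
      rw [h1, h2]
      exact prod_mem fun t _ => zpow_mem (hmem t) _
    have hle := htd.trans (tdQ_le_of_subset_adjoin (hS.trans hadj))
    refine algebraicIndependent_of_card_le_trdeg ?_
    rw [Cardinal.lift_id, Cardinal.lift_id, Cardinal.mk_fintype, Fintype.card_subtype_compl,
      Fintype.card_subtype_eq]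
    exact hle
  have : Algebra.IsAlgebraic ℚ QAlg := algebraicClosure.isAlgebraic ℚ ℂ
  have hindA : AlgebraicIndependent QAlg η := hind.extendScalars QAlg
  let φ : (ι →₀ ℕ) → {t // t ≠ s} → ℤ := fun α t => m s * α t - m t * α s
  have hmono : ∀ α : ι →₀ ℕ, ∏ t, Complex.exp (l t) ^ α t = ∏ t, η t ^ φ α t := by
    intro α
    rw [← hηexp]
    simp only [φ]
    push_cast
    rw [← hsum fun t => (α t : ℂ), Complex.exp_sum]
    exact Finset.prod_congr rfl fun t _ => (Complex.exp_nat_mul _ _).symm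
  -- A common shift that makes all exponents nonnegative, turning a Laurent relation into a
  -- polynomial one.
  let N : ℕ := ∑ α ∈ g.support, ∑ t, (φ α t).natAbs
  have hN : ∀ α ∈ g.support, ∀ t, 0 ≤ φ α t + N := by
    intro α hα t
    have h1 : (φ α t).natAbs ≤ N := (Finset.single_le_sum (f := fun t => (φ α t).natAbs)
      (fun _ _ => Nat.zero_le _) (Finset.mem_univ t)).trans
      (Finset.single_le_sum (f := fun α => ∑ t, (φ α t).natAbs) (fun _ _ => Nat.zero_le _) hα)
    omega
  let ψ : (ι →₀ ℕ) → {t // t ≠ s} →₀ ℕ := fun α =>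
    Finsupp.equivFunOnFinite.symm fun t => (φ α t + N).toNat
  have hq : ∑ α ∈ g.support, monomial (ψ α) (g.coeff α) = 0 := by
    refine hindA.eq_zero_of_aeval_eq_zero _ ?_
    have hη0 : ∀ t, η t ≠ 0 := fun t => Complex.exp_ne_zero _
    rw [aeval_def, eval₂_eq'] at hgl
    rw [map_sum]
    have : ∀ α ∈ g.support, aeval η (monomial (ψ α) (g.coeff α)) =
        (∏ t, η t ^ N) * (algebraMap QAlg ℂ (g.coeff α) * ∏ t, Complex.exp (l t) ^ α t) := by
      intro α hα
      rw [aeval_monomial, hmono, Finsupp.prod_fintype _ _ (fun _ => pow_zero _), mul_left_comm,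
        ← Finset.prod_mul_distrib]
      congr 1
      refine Finset.prod_congr rfl fun t _ => ?_
      simp only [ψ, Finsupp.equivFunOnFinite_symm_apply_apply]
      rw [← zpow_natCast, Int.toNat_of_nonneg (hN α hα t), zpow_add₀ (hη0 t), zpow_natCast,
        mul_comm]
    rw [Finset.sum_congr rfl this, ← Finset.mul_sum, hgl, mul_zero]
  obtain ⟨α, hα⟩ := support_nonempty.2 hg
  -- If no other monomial collided with `α`, its nonzero coefficient would survive in a polynomial
  -- that is zero. The difference `β - α` is the required vector.
  obtain ⟨β, hβ, hne, hψ⟩ : ∃ β ∈ g.support, β ≠ α ∧ ψ β = ψ α := by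
    by_contra! hcon
    have h1 := congrArg (coeff (ψ α)) hq
    rw [coeff_sum, coeff_zero, Finset.sum_eq_single α, coeff_monomial, if_pos rfl] at h1
    · exact mem_support_iff.1 hα h1
    · intro β hβ hne
      rw [coeff_monomial, if_neg (hcon β hβ hne)]
    · exact fun h => absurd hα h
  refine ⟨fun t => (β t : ℤ) - α t, fun h => hne ?_, fun t => ?_, fun t => ?_⟩
  · ext t
    have := congrFun h t
    simp only [Pi.zero_apply] at this
    omega
  · have h1 := (monomial_le_degreeOf t hα).trans (degreeOf_le_totalDegree g t)
    have h2 := (monomial_le_degreeOf t hβ).trans (degreeOf_le_totalDegree g t)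
    simp only
    rw [abs_le]
    omega
  · rcases eq_or_ne t s with rfl | ht
    · exact mul_comm _ _
    · have h1 := DFunLike.congr_fun hψ ⟨t, ht⟩
      simp only [ψ, Finsupp.equivFunOnFinite_symm_apply_apply] at h1
      have h2 := hN α hα ⟨t, ht⟩
      have h3 := hN β hβ ⟨t, ht⟩
      have h4 : φ β ⟨t, ht⟩ = φ α ⟨t, ht⟩ := by omega
      simp only [φ] at h4
      linarith

open MvPolynomial in
/-- A linear relation between the iterated exponentials of a zero of `p` with transcendence degree
one less than expected can be replaced by one whose coefficients are bounded in terms of `p`. -/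
theorem exists_bounded_relation {k : ℕ} {p : MvPolynomial (Fin (k + 1)) QAlg} (hp : Irreducible p)
    (hp_last : Fin.last k ∈ p.vars) {a : ℂ} (ha : a ≠ 0)
    (hpa : aeval (fun i : Fin (k + 1) => iterExp i a) p = 0)
    (htd : ((k - 1 : ℕ) : Cardinal) ≤ tdQ (Set.range fun i : Fin (k + 1) => iterExp i a))
    {m : Fin k → ℤ} (hm0 : m ≠ 0) (hm : ∑ i, (m i : ℂ) * iterExp i a = 0) :
    ∃ v : Fin k → ℤ, v ≠ 0 ∧ (∀ i, |v i| ≤ p.totalDegree) ∧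
      ∑ i, (v i : ℂ) * iterExp i a = 0 := by
  classical
  -- Minimality of `s` matters: the coordinates left after removing `x s` are `e_t(a)` for `t < s`
  -- and `exp (e_t(a))` for `t ≥ s`. Writing the former as exponentials of logarithms leaves the
  -- relation intact, because `m` vanishes there.
  obtain ⟨s, hs, hmin⟩ : ∃ s, m s ≠ 0 ∧ ∀ t < s, m t = 0 := by
    obtain ⟨i, hi⟩ := Function.ne_iff.1 hm0
    have hne : (Finset.univ.filter fun i => m i ≠ 0).Nonempty := ⟨i, by simpa using hi⟩
    refine ⟨_, (Finset.mem_filter.1 (Finset.min'_mem _ hne)).2, fun t ht => ?_⟩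
    by_contra h
    exact absurd (Finset.min'_le _ t (by simpa using h)) (not_le.2 ht)
  have hx0 : ∀ i, iterExp i a ≠ 0 := by
    rintro (_ | i)
    · exact ha
    · exact Complex.exp_ne_zero _
  let x : Fin (k + 1) → ℂ := fun i => iterExp i a
  let m' : Fin (k + 1) → ℤ := Fin.snoc m 0
  have hm' : ∑ i, (m' i : ℂ) * x i = 0 := by
    rw [Fin.sum_univ_castSucc]
    simpa [m', x] using hm
  obtain ⟨g, hg, hgx, hgdeg⟩ := exists_eliminant hp hp_last (j := s.castSucc)
    (m := fun i => (m' i : QAlg)) (by simpa [m'] using hs) (by simp [m']) (x := x)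
    (by simpa using hm') hpa
  let l : Fin k → ℂ := fun t => if t < s then Complex.log (iterExp t a) else iterExp t a
  have hl : ∀ t, Complex.exp (l t) = x (s.castSucc.succAbove t) := by
    intro t
    simp only [l, x]
    split_ifs with h
    · rw [Complex.exp_log (hx0 _), Fin.succAbove_of_castSucc_lt _ _ (by simpa using h)]
      rfl
    · rw [Fin.succAbove_of_le_castSucc _ _ (by simpa using h)]
      rfl
  have hml : ∑ t, (m t : ℂ) * l t = 0 := by
    rw [← hm]
    refine Finset.sum_congr rfl fun t _ => ?_
    simp only [l]
    split_ifs with h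
    · simp [hmin t h]
    · rfl
  have hy : ∀ t, x (s.castSucc.succAbove t) ∈
      IntermediateField.adjoin ℚ (Set.range fun t => Complex.exp (l t)) := fun t =>
    IntermediateField.subset_adjoin _ _ ⟨t, hl t⟩
  have hS : (Set.range fun i : Fin (k + 1) => iterExp i a) ⊆
      IntermediateField.adjoin ℚ (Set.range fun t => Complex.exp (l t)) := by
    rintro _ ⟨i, rfl⟩
    refine s.castSucc.succAboveCases ?_ (fun t => hy t) i
    change x s.castSucc ∈ IntermediateField.adjoin ℚ (Set.range fun t => Complex.exp (l t))
    rw [Fin.sum_univ_succAbove _ s.castSucc] at hm'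
    have hs' : (m' s.castSucc : ℂ) ≠ 0 := by simpa [m'] using hs
    have e : x s.castSucc = -(∑ t, (m' (s.castSucc.succAbove t) : ℂ) *
        x (s.castSucc.succAbove t)) / m' s.castSucc := by
      rw [eq_div_iff hs', mul_comm]
      exact eq_neg_of_add_eq_zero_left hm'
    rw [e]
    exact div_mem (neg_mem (sum_mem fun t _ => mul_mem (intCast_mem _ _) (hy t))) (intCast_mem _ _)
  obtain ⟨v, hv0, hvd, hv⟩ := exists_proportional_exponent hs hml hg (by simpa only [hl] using hgx)
    hS (by simpa using htd)
  refine ⟨v, hv0, fun t => (hvd t).trans (by exact_mod_cast hgdeg), ?_⟩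
  have hs' : (m s : ℂ) ≠ 0 := by exact_mod_cast hs
  rw [← mul_right_inj' hs', mul_zero, ← mul_zero (v s : ℂ), ← hm, Finset.mul_sum, Finset.mul_sum]
  refine Finset.sum_congr rfl fun t _ => ?_
  have := congrArg (Int.cast : ℤ → ℂ) (hv t)
  push_cast at this
  rw [← mul_assoc, this, mul_assoc]

/-! ### Transcendence degrees zero and one -/

theorem SchanuelConjecture.tdQ_ne_zero (hSC : SchanuelConjecture) {a : ℂ} {T : Set ℂ} (ha : a ≠ 0)
    (haT : a ∈ T) (hexp : Complex.exp a ∈ T) : tdQ T ≠ 0 := by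
  intro h
  obtain ⟨m, hm0, hm⟩ := hSC.exists_int_relation (l := fun _ : Fin 1 => a) (fun _ => haT)
    (fun _ => hexp) (by simp [h])
  obtain ⟨i, hi⟩ := Function.ne_iff.1 hm0
  rw [Subsingleton.elim i 0] at hi
  simp only [Finset.univ_unique, Finset.sum_singleton, mul_eq_zero, ha, or_false,
    Int.cast_eq_zero] at hm
  exact hi hm

theorem SchanuelConjecture.exists_eq_rat_mul (hSC : SchanuelConjecture) {a b : ℂ} {T : Set ℂ}
    (ha : a ≠ 0) (haT : a ∈ T) (hexpa : Complex.exp a ∈ T) (hbT : b ∈ T)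
    (hexpb : Complex.exp b ∈ T) (hT : tdQ T = 1) : ∃ r : ℚ, b = r * a := by
  obtain ⟨m, hm0, hm⟩ := hSC.exists_int_relation (l := ![a, b]) (T := T)
    (by simp [Fin.forall_fin_two, *]) (by simp [Fin.forall_fin_two, *])
    (by rw [hT]; exact_mod_cast one_lt_two)
  simp only [Fin.sum_univ_two, Matrix.cons_val_zero, Matrix.cons_val_one] at hm
  have hm1 : (m 1 : ℂ) ≠ 0 := by
    intro h1
    rw [h1, zero_mul, add_zero, mul_eq_zero, or_iff_left ha] at hm
    refine hm0 (funext fun i => ?_)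
    revert i
    rw [Fin.forall_fin_two]
    exact ⟨by exact_mod_cast hm, by exact_mod_cast h1⟩
  refine ⟨-m 0 / m 1, ?_⟩
  push_cast
  field_simp
  linear_combination hm

/-- Schanuel for pairs gives `e_1(a) = r a` and `e_2(a) = s a` with `r, s` rational; the second
needs `e_3(a) ∈ T`. Comparing powers of `exp (r a)` and `exp a` makes a power of `a` rational, so
either `r = 1` or both `a` and `exp a` are algebraic, which degree zero excludes. -/
theorem SchanuelConjecture.exp_eq_self_of_tdQ_eq_one (hSC : SchanuelConjecture) {a : ℂ} {T : Set ℂ}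
    (ha : a ≠ 0) (h : ∀ i ≤ 3, iterExp i a ∈ T) (hT : tdQ T = 1) : Complex.exp a = a := by
  have h0 : a ∈ T := h 0 (by norm_num)
  have h1 : Complex.exp a ∈ T := h 1 (by norm_num)
  have h2 : Complex.exp (Complex.exp a) ∈ T := h 2 (by norm_num)
  have h3 : Complex.exp (Complex.exp (Complex.exp a)) ∈ T := h 3 le_rfl
  obtain ⟨r, hr⟩ := hSC.exists_eq_rat_mul ha h0 h1 h1 h2 hT
  obtain ⟨s, hs⟩ := hSC.exists_eq_rat_mul ha h0 h1 h2 h3 hT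
  have hr0 : r ≠ 0 := by
    rintro rfl
    simp at hr
  have hs0 : s ≠ 0 := by
    rintro rfl
    simp at hs
  have hd : (r.den : ℂ) ≠ 0 := by exact_mod_cast r.den_ne_zero
  have hrd : (r.den : ℂ) * r = r.num := by exact_mod_cast Rat.den_mul_eq_num r
  have key : (s * a) ^ r.den = (r * a) ^ r.num := by
    rw [← hs, ← hr, ← Complex.exp_int_mul, ← Complex.exp_nat_mul, hr, ← mul_assoc, hrd]
  have key2 : a ^ ((r.den : ℤ) - r.num) = ((r ^ r.num / s ^ r.den : ℚ) : ℂ) := by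
    have hsC : (s : ℂ) ≠ 0 := by exact_mod_cast hs0
    rw [mul_pow, mul_zpow] at key
    rw [zpow_sub₀ ha, zpow_natCast]
    push_cast
    rw [div_eq_div_iff (zpow_ne_zero _ ha) (pow_ne_zero _ hsC), mul_comm, key]
  by_cases hn : (r.den : ℤ) - r.num = 0
  · have : r = 1 := by
      rw [← Rat.num_div_den r, ← sub_eq_zero.1 hn]
      simp
    rw [hr, this]
    simp
  · have halg : IsAlgebraic ℚ a := by
      have h4 : IsAlgebraic ℚ (a ^ ((r.den : ℤ) - r.num)) := by
        rw [key2]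
        exact isAlgebraic_algebraMap (A := ℂ) (r ^ r.num / s ^ r.den : ℚ)
      have h5 : IsAlgebraic ℚ (a ^ ((r.den : ℤ) - r.num).natAbs) := by
        rcases Int.natAbs_eq ((r.den : ℤ) - r.num) with h | h
        · rwa [h, zpow_natCast] at h4
        · rw [h, zpow_neg, zpow_natCast] at h4
          simpa using h4.inv
      exact h5.of_pow (Int.natAbs_pos.2 hn)
    refine absurd (tdQ_eq_zero (T := {a, Complex.exp a}) ?_)
      (hSC.tdQ_ne_zero ha (Set.mem_insert _ _) (Set.mem_insert_of_mem _ rfl))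
    rintro _ (rfl | rfl)
    · exact halg
    · rw [hr]
      exact (isAlgebraic_algebraMap (A := ℂ) r).mul halg

/-! ### The main theorem -/

theorem mainTheorem4 (hSC : SchanuelConjecture) (k : ℕ) (hk : 2 ≤ k)
    (p : MvPolynomial (Fin (k + 1)) QAlg) (hp : Irreducible p)
    (hp_first : 0 ∈ p.vars) (hp_last : Fin.last k ∈ p.vars) :
    ∃ a : ℂ,
      MvPolynomial.aeval (fun i : Fin (k + 1) => iterExp i a) p = 0 ∧
      tdQ (Set.range fun i : Fin (k + 1) => iterExp i a) ≠ 0 ∧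
      tdQ (Set.range fun i : Fin (k + 1) => iterExp i a) ≠ 1 ∧
      tdQ (Set.range fun i : Fin (k + 1) => iterExp i a) ≠ ((k - 1 : ℕ) : Cardinal) := by
  obtain ⟨n, rfl⟩ : ∃ n, k = n + 2 := ⟨k - 2, by omega⟩
  -- The degree bounds the relations arising in transcendence degree `k - 1`; the bound one covers
  -- `a = 0` and `exp a = a`.
  obtain ⟨a, hpa, hav⟩ := exists_iterExp_zero_avoiding hp hp_first hp_last (max 1 p.totalDegree)
  set T := Set.range fun i : Fin (n + 2 + 1) => iterExp i a with hT
  have hmem : ∀ i ≤ n + 2, iterExp i a ∈ T := fun i hi => ⟨⟨i, by omega⟩, rfl⟩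
  have ha : a ≠ 0 := by
    rintro rfl
    refine hav (Pi.single 0 1) (by simp) (fun i => ?_) ?_
    · rw [Pi.single_apply]
      split_ifs <;> simp
    · rw [Fintype.sum_eq_single 0 fun i hi => by simp [hi]]
      simp [iterExp]
  have hexp : Complex.exp a ≠ a := by
    intro h
    refine hav (Pi.single 1 1 - Pi.single 0 1) ?_ (fun i => ?_) ?_
    · intro h0
      have := congrFun h0 0
      simp at this
    · simp only [Pi.sub_apply, Pi.single_apply]
      split_ifs with h1 h2
      · simp
      · simp
      · simp
      · simp
    · simp only [Pi.sub_apply, Int.cast_sub, sub_mul, Finset.sum_sub_distrib]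
      rw [Fintype.sum_eq_single 1 fun i hi => by simp [hi],
        Fintype.sum_eq_single 0 fun i hi => by simp [hi]]
      simp [iterExp, h]
  have hlast : tdQ T ≠ ((n + 2 - 1 : ℕ) : Cardinal) := by
    intro h
    obtain ⟨m, hm0, hm⟩ := hSC.exists_int_relation (T := T)
      (l := fun i : Fin (n + 2) => iterExp i a) (fun i => hmem i (by omega))
      (fun i => hmem (i + 1) (by omega)) (by rw [h]; exact_mod_cast (by omega))
    obtain ⟨v, hv0, hvd, hv⟩ := exists_bounded_relation hp hp_last ha hpa h.ge hm0 hm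
    exact hav v hv0 (fun i => (hvd i).trans (by exact_mod_cast le_max_right _ _)) hv
  refine ⟨a, hpa, hSC.tdQ_ne_zero ha (hmem 0 (by omega)) (hmem 1 (by omega)), fun h => ?_, hlast⟩
  -- For `k = 2` the degrees `1` and `k - 1` coincide; for `k ≥ 3` the third iterate is available.
  rcases Nat.eq_zero_or_pos n with rfl | hn
  · exact hlast (by simpa using h)
  · exact hexp (hSC.exp_eq_self_of_tdQ_eq_one ha (fun i hi => hmem i (by omega)) h)
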